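/- Let $T$ be a compact Hausdorff space (for instance a compact metric space, or a finite discrete set), let $t\mapsto a_t\in\mathbb{R}^n$ be continuous on $T$, and for $b\in C(T,\mathbb{R})$ let $\mathcal{F}(b)=\{x\in\mathbb{R}^n : a_t'x\le b_t \text{ for all } t\in T\}$. Equip $\mathbb{R}^n$ with an arbitrary norm $\|\cdot\|$, with dual norm $\|u\|_*=\max_{\|x\|\le 1}|u'x|$, and $C(T,\mathbb{R})$ with the supremum norm. Distances to sets are infima, $d_*$ is the distance for $\|\cdot\|_*$, and $\inf\emptyset=+\infty$, $(+\infty)^{-1}=0$; so $d_*(0,\emptyset)^{-1}=0$. All moduli take values in $[0,+\infty]$. Fix $\bar b$ with $\mathcal{F}(\bar b)\neq\emptyset$. The Hoffman modulus $\operatorname{Hof}\mathcal{F}(\bar b)$ is the infimum of the constants $\kappa\ge 0$ such that $d(x,\mathcal{F}(\bar b))\le\kappa\, d(\bar b,\mathcal{F}^{-1}(x))$ for all $x\in\mathbb{R}^n$, where $\mathcal{F}^{-1}(x)=\{b : x\in\mathcal{F}(b)\}$; for $\bar x\in\mathcal{F}(\bar b)$, the calmness modulus $\operatorname{clm}\mathcal{F}(\bar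 b,\bar x)$ is the infimum of the $\kappa\ge0$ for which this inequality holds for all $x$ in some neighborhood of $\bar x$. For $x\in\mathcal{F}(\bar b)$ let $T(x)=\{t\in T: a_t'x=\bar b_t\}$, let $A(x)$ be the convex cone generated by $\{0\}\cup\{a_t:t\in T(x)\}$, with negative polar $A(x)^\circ=\{u : u'v\le 0 \text{ for all } v\in A(x)\}$, and let $\mathcal{D}(x)$ be the family of all $D\subset T(x)$ for which there is $d\in\mathbb{R}^n$ with $a_t'd=1$ for $t\in D$ and $a_t'd<1$ for $t\in T(x)\setminus D$. Assume that the system is locally polyhedral: for every $x\in\mathcal{F}(\bar b)$, the cone of feasible directions $\{d : \exists\,\varepsilon>0,\ x+\alpha d\in\mathcal{F}(\bar b)\text{ for all }\alpha\in[0,\varepsilon]\}$ equals $A(x)^\circ$. Let $\mathcal{E}(\bar b)$ be the set of extreme points of $\mathcal{F}(\bar b)\cap\operatorname{span}\{a_t:t\in T\}$. Then $$\operatorname{Hof}\mathcal{F}(\bar b)=\sup_{x\in\mathcal{E}(\bar b)}\operatorname{clm}\mathcal{F}(\bar b,x)=\sup_{x\in\mathcal{E}(\bar b)}\ \sup_{D\in\mathcal{D}(x)}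 d_*\big(0,\operatorname{conv}\{a_t:t\in D\}\big)^{-1}.$$ If moreover $T$ is finite, then $\mathcal{E}(\bar b)$ is finite and nonempty, $\mathcal{D}(x)$ is finite and nonempty for every $x\in\mathcal{E}(\bar b)$, and $\operatorname{Hof}\mathcal{F}(\bar b)$ is attained both as $\operatorname{clm}\mathcal{F}(\bar b,x)$ for some $x\in\mathcal{E}(\bar b)$ and as $d_*(0,\operatorname{conv}\{a_t:t\in D\})^{-1}$ for some $x\in\mathcal{E}(\bar b)$ and $D\in\mathcal{D}(x)$ (the suprema are maxima over finite sets). -/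

import Mathlib

open scoped ENNReal NNReal Topology Matrix

noncomputable section

namespace LinSys

section Multifunctions

variable {Y X : Type*} [PseudoMetricSpace Y] [PseudoMetricSpace X]

/-- Hoffman modulus of a multifunction `M : Y ⇉ X` at `y₀`: the infimum (in `[0, ∞]`) of the
constants `κ ≥ 0` such that `d(x, M y₀) ≤ κ d(y₀, M⁻¹ x)` for all `x`. -/
def hoffmanModulus (M : Y → Set X) (y₀ : Y) : ℝ≥0∞ :=
  ⨅ (κ : ℝ≥0) (_ : ∀ x : X,
    Metric.infEDist x (M y₀) ≤ (κ : ℝ≥0∞) * Metric.infEDist y₀ {y | x ∈ M y}), (κ : ℝ≥0∞)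

/-- Calmness modulus of `M : Y ⇉ X` at `(y₀, x₀)`: the infimum (in `[0, ∞]`) of the constants
`κ ≥ 0` such that `d(x, M y₀) ≤ κ d(y₀, M⁻¹ x)` for all `x` in a neighborhood of `x₀`. -/
def calmnessModulus (M : Y → Set X) (y₀ : Y) (x₀ : X) : ℝ≥0∞ :=
  ⨅ (κ : ℝ≥0) (_ : ∀ᶠ x in 𝓝 x₀,
    Metric.infEDist x (M y₀) ≤ (κ : ℝ≥0∞) * Metric.infEDist y₀ {y | x ∈ M y}), (κ : ℝ≥0∞)

end Multifunctions

section Norms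

variable {n : ℕ}

/-- The distance `(x, y) ↦ p (x - y)` on `ℝⁿ`, with its topology. It is a metric when `p` is a
norm. It is deliberately not an instance: `Fin n → ℝ` carries the metric of the maximum norm. -/
@[reducible] def normMetric (p : Seminorm ℝ (Fin n → ℝ)) : PseudoMetricSpace (Fin n → ℝ) :=
  p.toAddGroupSeminorm.toSeminormedAddCommGroup.toPseudoMetricSpace

/-- The dual norm `‖u‖_* = sup {|u'x| : p x ≤ 1}`, with values in `[0, ∞]`. -/
def dualNorm (p : Seminorm ℝ (Fin n → ℝ)) (u : Fin n → ℝ) : ℝ≥0∞ :=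
  ⨆ (x : Fin n → ℝ) (_ : p x ≤ 1), ENNReal.ofReal |u ⬝ᵥ x|

/-- The distance from `v` to `S` for the dual norm; it is `∞` if `S` is empty. -/
def dualDist (p : Seminorm ℝ (Fin n → ℝ)) (v : Fin n → ℝ) (S : Set (Fin n → ℝ)) : ℝ≥0∞ :=
  ⨅ u ∈ S, dualNorm p (v - u)

/-- The negative polar `S°`. -/
def negPolar (S : Set (Fin n → ℝ)) : Set (Fin n → ℝ) :=
  {u | ∀ x ∈ S, u ⬝ᵥ x ≤ 0}

/-- The cone of feasible directions of `C` at `x`. -/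
def feasibleDirections (C : Set (Fin n → ℝ)) (x : Fin n → ℝ) : Set (Fin n → ℝ) :=
  {d | ∃ ε > (0 : ℝ), ∀ α ∈ Set.Icc 0 ε, x + α • d ∈ C}

end Norms

section Systems

variable {n : ℕ} {T : Type*} [TopologicalSpace T]

/-- The feasible set mapping `F(b) = {x : a_t' x ≤ b_t for all t ∈ T}`. -/
def feasibleSet (a : C(T, Fin n → ℝ)) (b : C(T, ℝ)) : Set (Fin n → ℝ) :=
  {x | ∀ t, a t ⬝ᵥ x ≤ b t}

/-- The set `T(x)` of active indices. -/
def activeIndices (a : C(T, Fin n → ℝ)) (b : C(T, ℝ)) (x : Fin n → ℝ) : Set T :=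
  {t | a t ⬝ᵥ x = b t}

/-- The active cone `A(x) = cone {a_t : t ∈ T(x)}`; it contains `0`. -/
def activeCone (a : C(T, Fin n → ℝ)) (b : C(T, ℝ)) (x : Fin n → ℝ) : Set (Fin n → ℝ) :=
  (Submodule.span ℝ≥0 (a '' activeIndices a b x) : Set (Fin n → ℝ))

/-- The system `{a_t' x ≤ b_t, t ∈ T}` is locally polyhedral. -/
def IsLOP (a : C(T, Fin n → ℝ)) (b : C(T, ℝ)) : Prop :=
  ∀ x ∈ feasibleSet a b,
    feasibleDirections (feasibleSet a b) x = negPolar (activeCone a b x)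

/-- The family `𝒟(x)` of the sets `D ⊆ T(x)` for which some `d` satisfies `a_t' d = 1` for `t ∈ D`
and `a_t' d < 1` for `t ∈ T(x) \ D`. -/
def hyperplaneFamily (a : C(T, Fin n → ℝ)) (b : C(T, ℝ)) (x : Fin n → ℝ) : Set (Set T) :=
  {D | D ⊆ activeIndices a b x ∧ ∃ d : Fin n → ℝ,
    (∀ t ∈ D, a t ⬝ᵥ d = 1) ∧ ∀ t ∈ activeIndices a b x \ D, a t ⬝ᵥ d < 1}

/-- The set `E(b)` of extreme points of `F(b) ∩ span {a_t : t ∈ T}`. -/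
def extremeSet (a : C(T, Fin n → ℝ)) (b : C(T, ℝ)) : Set (Fin n → ℝ) :=
  Set.extremePoints ℝ (feasibleSet a b ∩ (Submodule.span ℝ (Set.range a) : Set (Fin n → ℝ)))

variable [CompactSpace T]

/-- `Hof F(b)`, with `C(T, ℝ)` under the supremum norm and `ℝⁿ` under the norm `p`. -/
def hofF (p : Seminorm ℝ (Fin n → ℝ)) (a : C(T, Fin n → ℝ)) (b : C(T, ℝ)) : ℝ≥0∞ :=
  @hoffmanModulus C(T, ℝ) (Fin n → ℝ) _ (normMetric p) (feasibleSet a) b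

/-- `clm F(b, x)`, with `C(T, ℝ)` under the supremum norm and `ℝⁿ` under the norm `p`. -/
def clmF (p : Seminorm ℝ (Fin n → ℝ)) (a : C(T, Fin n → ℝ)) (b : C(T, ℝ))
    (x : Fin n → ℝ) : ℝ≥0∞ :=
  @calmnessModulus C(T, ℝ) (Fin n → ℝ) _ (normMetric p) (feasibleSet a) b x

end Systems

end LinSys

end

namespace LinSys

variable {n : ℕ}

/-! The three quantities are compared in a cycle. Calmness at a point never exceeds the Hoffman
modulus. `inv_dualDist_le_clmF` bounds calmness from below: leaving an extreme point e along the d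
of some D ∈ 𝒟(e), the constraint violation grows at rate about 1, while each q ∈ conv {a_t : t ∈ D}
forces the distance to the feasible set to grow at rate at least 1/‖q‖_*.

The cycle is closed by `hofF_le_of_forall_inv_dualDist_le`. If y is a feasible point nearest to an
infeasible x, some normal u at y satisfies ‖u‖_* ‖x - y‖ ≤ u'(x - y), and local polyhedrality puts u
in the closure of A(y). `IsLOP.exists_mem_extremeSet` supplies an extreme e with T(y) ⊆ T(e), so y
can be replaced by e. It remains to bound u'(x - e) by κ ‖u‖_* times the parameter error. For
positive multiples of points of conv {a_t : t ∈ D} this is direct; `mem_of_mem_cone` extends it to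
the whole cone by limits, even if the cone is not closed, and continuity of the dual norm extends it
to the closure. -/

/-! ### Projection, separation and a compactness argument -/

theorem dot_self_nonneg (x : Fin n → ℝ) : 0 ≤ x ⬝ᵥ x :=
  Finset.sum_nonneg fun i _ => mul_self_nonneg (x i)

/-- Existence of Euclidean projections onto closed convex sets, in terms of the dot product. -/
theorem exists_projection {P : Set (Fin n → ℝ)} (hne : P.Nonempty) (hcl : IsClosed P)
    (hconv : Convex ℝ P) (x : Fin n → ℝ) :
    ∃ d ∈ P, ∀ y ∈ P, (x - d) ⬝ᵥ (y - d) ≤ 0 := by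
  let K : Set (EuclideanSpace ℝ (Fin n)) := {z | z.ofLp ∈ P}
  have hKcl : IsClosed K := hcl.preimage (PiLp.continuous_ofLp 2 _)
  have hKconv : Convex ℝ K := fun z hz w hw s t hs ht hst => hconv hz hw hs ht hst
  obtain ⟨p, hp⟩ := hne
  obtain ⟨v, hv, hmin⟩ := exists_norm_eq_iInf_of_complete_convex (K := K)
    ⟨WithLp.toLp 2 p, hp⟩ hKcl.isComplete hKconv (WithLp.toLp 2 x)
  have h := (norm_eq_iInf_iff_real_inner_le_zero hKconv hv).1 hmin
  refine ⟨v.ofLp, hv, fun y hy => ?_⟩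
  have h1 := h (WithLp.toLp 2 y) hy
  rw [EuclideanSpace.inner_eq_star_dotProduct, star_trivial] at h1
  rw [dotProduct_comm]
  exact h1

/-- Separation of a point from the closure of a convex cone. -/
theorem exists_separation_of_notMem_closure (K : Submodule ℝ≥0 (Fin n → ℝ)) {u : Fin n → ℝ}
    (hu : u ∉ closure (K : Set (Fin n → ℝ))) :
    ∃ w : Fin n → ℝ, 0 < u ⬝ᵥ w ∧ ∀ v ∈ K, v ⬝ᵥ w ≤ 0 := by
  have hconv : Convex ℝ (K : Set (Fin n → ℝ)) := fun x hx y hy s t hs ht _ =>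
    K.add_mem (K.smul_mem ⟨s, hs⟩ hx) (K.smul_mem ⟨t, ht⟩ hy)
  obtain ⟨q, hq, hproj⟩ := exists_projection (P := closure (K : Set (Fin n → ℝ)))
    ⟨0, subset_closure K.zero_mem⟩ isClosed_closure hconv.closure u
  have hadd : ∀ v ∈ K, q + v ∈ closure (K : Set (Fin n → ℝ)) := fun v hv =>
    map_mem_closure (f := fun x => x + v) (by fun_prop) hq fun x hx => K.add_mem hx hv
  have hdouble : q + q ∈ closure (K : Set (Fin n → ℝ)) :=
    map_mem_closure (f := fun x => x + x) (by fun_prop) hq fun x hx => K.add_mem hx hx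
  have h0 := hproj 0 (subset_closure K.zero_mem)
  have h2 := hproj _ hdouble
  rw [add_sub_cancel_right] at h2
  rw [zero_sub, dotProduct_neg] at h0
  -- The residual separates: testing the projection against 0 gives (u - q)'q ≥ 0, and against q + v
  -- gives (u - q)'v ≤ 0.
  refine ⟨u - q, ?_, fun v hv => ?_⟩
  · have h3 : u ⬝ᵥ (u - q) = (u - q) ⬝ᵥ (u - q) + (u - q) ⬝ᵥ q := by
      rw [← dotProduct_add, sub_add_cancel, dotProduct_comm]
    have h4 : (u - q) ⬝ᵥ (u - q) ≠ 0 := by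
      rw [Ne, dotProduct_self_eq_zero, sub_eq_zero]
      rintro rfl
      exact hu hq
    have h5 := lt_of_le_of_ne (dot_self_nonneg (u - q)) h4.symm
    linarith
  · have h3 := hproj _ (hadd v hv)
    rw [add_sub_cancel_left] at h3
    rwa [dotProduct_comm]

/-- If `g ≤ 0` on a compact set and `h < 0` wherever `g` vanishes, then `g + r h ≤ 0` for some
`r > 0`. -/
theorem exists_pos_add_mul_nonpos {X : Type*} [TopologicalSpace X] {K : Set X} (hK : IsCompact K)
    {g h : X → ℝ} (hg : Continuous g) (hh : Continuous h) (hg0 : ∀ s ∈ K, g s ≤ 0)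
    (hlt : ∀ s ∈ K, g s = 0 → h s < 0) :
    ∃ r > 0, ∀ s ∈ K, g s + r * h s ≤ 0 := by
  have hK1 : IsCompact (K ∩ {s | 0 ≤ h s}) := hK.inter_right (isClosed_le continuous_const hh)
  rcases (K ∩ {s | 0 ≤ h s}).eq_empty_or_nonempty with he | hne
  · refine ⟨1, one_pos, fun s hs => ?_⟩
    have h1 : ¬ 0 ≤ h s := fun hc => (Set.eq_empty_iff_forall_notMem.1 he s) ⟨hs, hc⟩
    linarith [hg0 s hs]
  · obtain ⟨s1, hs1, hmax1⟩ := hK1.exists_isMaxOn hne hg.continuousOn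
    obtain ⟨s2, hs2, hmax2⟩ := hK1.exists_isMaxOn hne hh.continuousOn
    have hη : g s1 < 0 := lt_of_le_of_ne (hg0 s1 hs1.1) fun hc =>
      absurd hs1.2 (not_le.2 (hlt s1 hs1.1 hc))
    have hH : 0 ≤ h s2 := hs2.2
    have hr : 0 < -g s1 / (h s2 + 1) := div_pos (by linarith) (by linarith)
    -- Only points with h ≥ 0 matter; there g ≤ g s1 < 0 and h ≤ h s2. The + 1 keeps the denominator
    -- positive.
    refine ⟨-g s1 / (h s2 + 1), hr, fun s hs => ?_⟩
    by_cases hc : 0 ≤ h s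
    · have h1 : g s ≤ g s1 := hmax1 ⟨hs, hc⟩
      have h2 : h s ≤ h s2 := hmax2 ⟨hs, hc⟩
      have h3 : -g s1 / (h s2 + 1) * (h s2 + 1) = -g s1 := div_mul_cancel₀ _ (by linarith)
      nlinarith
    · have := mul_neg_of_pos_of_neg hr (not_le.1 hc)
      linarith [hg0 s hs]

theorem dotProduct_nonpos_of_mem_span {S : Set (Fin n → ℝ)} {w v : Fin n → ℝ}
    (hS : ∀ s ∈ S, s ⬝ᵥ w ≤ 0) (hv : v ∈ Submodule.span ℝ≥0 S) : v ⬝ᵥ w ≤ 0 := by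
  induction hv using Submodule.span_induction with
  | mem x hx => exact hS x hx
  | zero => simp
  | add x y _ _ hx hy => rw [add_dotProduct]; linarith
  | smul c x _ hx =>
    rw [NNReal.smul_def, smul_dotProduct, smul_eq_mul]
    exact mul_nonpos_of_nonneg_of_nonpos c.2 hx

/-! ### Convex cones generated by compact sets -/

/-- Optimality conditions for maximizing a linear function over `{y : s'y ≤ 1 for all s ∈ S}`. -/
theorem mem_closure_cone_of_isMax {S : Set (Fin n → ℝ)} (hS : IsCompact S) {d u : Fin n → ℝ}
    (hd : ∀ s ∈ S, s ⬝ᵥ d ≤ 1)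
    (hu : ∀ y : Fin n → ℝ, (∀ s ∈ S, s ⬝ᵥ y ≤ 1) → u ⬝ᵥ (y - d) ≤ 0) :
    u ∈ closure (Submodule.span ℝ≥0 {s ∈ S | s ⬝ᵥ d = 1} : Set (Fin n → ℝ)) := by
  by_contra hcon
  obtain ⟨w, hw, hK⟩ := exists_separation_of_notMem_closure _ hcon
  have hD : 0 < 2 * (|u ⬝ᵥ d| + 1) := by positivity
  -- Tilting w to w - δd makes it strictly negative on the active s; this δ is small enough that
  -- u'(w - δd) stays positive.
  set δ : ℝ := u ⬝ᵥ w / (2 * (|u ⬝ᵥ d| + 1)) with hδ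
  have hδ0 : 0 < δ := div_pos hw hD
  have hδ1 : δ * (2 * (|u ⬝ᵥ d| + 1)) = u ⬝ᵥ w := div_mul_cancel₀ _ hD.ne'
  obtain ⟨r, hr, hfeas⟩ := exists_pos_add_mul_nonpos hS (g := fun s => s ⬝ᵥ d - 1)
    (h := fun s => s ⬝ᵥ (w - δ • d)) (by fun_prop) (by fun_prop)
    (fun s hs => by linarith [hd s hs]) (fun s hs h0 => by
      have h1 : s ⬝ᵥ d = 1 := by linarith
      have h2 := hK s (Submodule.subset_span ⟨hs, h1⟩)
      rw [dotProduct_sub, dotProduct_smul, h1, smul_eq_mul]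
      linarith)
  have h1 := hu (d + r • (w - δ • d)) fun s hs => by
    have := hfeas s hs
    rw [dotProduct_add, dotProduct_smul, smul_eq_mul]
    linarith
  rw [add_sub_cancel_left, dotProduct_smul, dotProduct_sub, dotProduct_smul, smul_eq_mul,
    smul_eq_mul] at h1
  have h2 : 0 < u ⬝ᵥ w - δ * u ⬝ᵥ d := by
    nlinarith [le_abs_self (u ⬝ᵥ d), mul_le_mul_of_nonneg_left (le_abs_self (u ⬝ᵥ d)) hδ0.le,
      mul_nonneg hδ0.le (abs_nonneg (u ⬝ᵥ d))]
  linarith [mul_pos hr h2]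

/-- Every element of `cone S` is a limit of elements of closed cones `cone {s ∈ S : s'd = 1}`,
where `d` satisfies `s'd ≤ 1` on `S`. -/
theorem mem_of_mem_cone {S : Set (Fin n → ℝ)} (hS : IsCompact S) {G : Set (Fin n → ℝ)}
    (hG : IsClosed G)
    (hface : ∀ d : Fin n → ℝ, (∀ s ∈ S, s ⬝ᵥ d ≤ 1) →
      (Submodule.span ℝ≥0 {s ∈ S | s ⬝ᵥ d = 1} : Set (Fin n → ℝ)) ⊆ G)
    {u : Fin n → ℝ} (hu : u ∈ Submodule.span ℝ≥0 S) : u ∈ G := by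
  have hgauge : ∃ γ : ℝ, 0 ≤ γ ∧ ∀ d : Fin n → ℝ, (∀ s ∈ S, s ⬝ᵥ d ≤ 1) → u ⬝ᵥ d ≤ γ := by
    induction hu using Submodule.span_induction with
    | mem x hx => exact ⟨1, zero_le_one, fun d hd => hd x hx⟩
    | zero => exact ⟨0, le_rfl, fun d _ => by simp⟩
    | add x y _ _ hx hy =>
      obtain ⟨γ, h0, h1⟩ := hx
      obtain ⟨γ', h0', h1'⟩ := hy
      refine ⟨γ + γ', by positivity, fun d hd => ?_⟩
      rw [add_dotProduct]
      linarith [h1 d hd, h1' d hd]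
    | smul c x _ hx =>
      obtain ⟨γ, h0, h1⟩ := hx
      refine ⟨c * γ, mul_nonneg c.2 h0, fun d hd => ?_⟩
      rw [NNReal.smul_def, smul_dotProduct, smul_eq_mul]
      exact mul_le_mul_of_nonneg_left (h1 d hd) c.2
  obtain ⟨γ, hγ0, hγ⟩ := hgauge
  let P : Set (Fin n → ℝ) := {d | ∀ s ∈ S, s ⬝ᵥ d ≤ 1}
  have hPcl : IsClosed P := by
    have : P = ⋂ s ∈ S, {d | s ⬝ᵥ d ≤ 1} := by ext; simp [P]
    rw [this]
    exact isClosed_biInter fun s _ => isClosed_le (by fun_prop) continuous_const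
  have hP0 : (0 : Fin n → ℝ) ∈ P := fun s _ => by simp
  have hPconv : Convex ℝ P := fun x hx y hy α β hα hβ hαβ s hs => by
    rw [dotProduct_add, dotProduct_smul, dotProduct_smul, smul_eq_mul, smul_eq_mul]
    nlinarith [hx s hs, hy s hs]
  -- A regularized maximization of u over P, whose maximum need not be attained. For ε > 0, u - ε
  -- d_ε is normal to P at d_ε, hence in the closure of a face cone; testing against 0 gives |ε
  -- d_ε|² ≤ εγ, so the error vanishes as ε → 0.
  choose d hdP hd using fun ε : ℝ => exists_projection ⟨0, hP0⟩ hPcl hPconv (ε⁻¹ • u)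
  have hbound : ∀ ε > 0, (ε • d ε) ⬝ᵥ (ε • d ε) ≤ ε * γ := fun ε hε => by
    have h1 := hd ε 0 hP0
    rw [zero_sub, dotProduct_neg, sub_dotProduct, smul_dotProduct, smul_eq_mul] at h1
    have h2 := hγ (d ε) (hdP ε)
    rw [smul_dotProduct, dotProduct_smul, smul_eq_mul, smul_eq_mul]
    have h3 : d ε ⬝ᵥ d ε ≤ ε⁻¹ * γ := by
      have := mul_le_mul_of_nonneg_left h2 (inv_pos.2 hε).le
      linarith
    calc ε * (ε * (d ε ⬝ᵥ d ε)) ≤ ε * (ε * (ε⁻¹ * γ)) := by gcongr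
      _ = ε * γ := by field_simp
  have hmem : ∀ ε > 0, u - ε • d ε ∈ G := fun ε hε => by
    refine hG.closure_subset_iff.2 (hface (d ε) (hdP ε))
      (mem_closure_cone_of_isMax hS (hdP ε) fun y hy => ?_)
    have h1 := hd ε y hy
    have h2 : u - ε • d ε = ε • (ε⁻¹ • u - d ε) := by
      rw [smul_sub, smul_smul, mul_inv_cancel₀ hε.ne', one_smul]
    rw [h2, smul_dotProduct]
    exact mul_nonpos_of_nonneg_of_nonpos hε.le h1
  have hlim : Filter.Tendsto (fun ε : ℝ => u - ε • d ε) (𝓝[>] 0) (𝓝 u) := by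
    have h0 : Filter.Tendsto (fun ε : ℝ => ε • d ε) (𝓝[>] 0) (𝓝 0) := by
      rw [tendsto_pi_nhds]
      intro i
      have hs : Filter.Tendsto (fun ε : ℝ => √(ε * γ)) (𝓝[>] 0) (𝓝 0) := by
        have : Continuous fun ε : ℝ => √(ε * γ) := by fun_prop
        simpa using this.continuousWithinAt (s := Set.Ioi 0) (x := 0) |>.tendsto
      refine squeeze_zero_norm' ?_ hs
      filter_upwards [self_mem_nhdsWithin] with ε hε
      rw [Real.norm_eq_abs]
      refine Real.abs_le_sqrt ((le_trans ?_ (hbound ε hε)))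
      rw [pow_two]
      exact Finset.single_le_sum (f := fun j => (ε • d ε) j * (ε • d ε) j)
        (fun j _ => mul_self_nonneg _) (Finset.mem_univ i)
    simpa using tendsto_const_nhds.sub h0
  refine hG.mem_of_tendsto hlim ?_
  filter_upwards [self_mem_nhdsWithin] with ε hε using hmem ε hε

/-- A nonzero element of a convex cone is a positive multiple of a convex combination of the
generators. -/
theorem exists_smul_of_mem_span {S : Set (Fin n → ℝ)} {v : Fin n → ℝ}
    (hv : v ∈ Submodule.span ℝ≥0 S) :
    v = 0 ∨ ∃ c : ℝ, 0 < c ∧ ∃ q ∈ convexHull ℝ S, v = c • q := by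
  induction hv using Submodule.span_induction with
  | mem x hx => exact .inr ⟨1, one_pos, x, subset_convexHull ℝ S hx, (one_smul ℝ x).symm⟩
  | zero => exact .inl rfl
  | add x y _ _ hx hy =>
    rcases hx with rfl | ⟨c, hc, q, hq, rfl⟩
    · simpa using hy
    rcases hy with rfl | ⟨c', hc', q', hq', rfl⟩
    · exact .inr ⟨c, hc, q, hq, add_zero _⟩
    refine .inr ⟨c + c', by positivity, (c / (c + c')) • q + (c' / (c + c')) • q',
      convex_convexHull ℝ S hq hq' (by positivity) (by positivity) (by field_simp), ?_⟩
    have : c + c' ≠ 0 := by positivity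
    rw [smul_add, smul_smul, smul_smul, mul_div_cancel₀ _ this, mul_div_cancel₀ _ this]
  | smul r x _ hx =>
    rcases hx with rfl | ⟨c, hc, q, hq, rfl⟩
    · exact .inl (smul_zero r)
    rcases eq_or_ne r 0 with rfl | hr
    · exact .inl (zero_smul _ _)
    · exact .inr ⟨r * c, mul_pos (NNReal.coe_pos.2 (pos_iff_ne_zero.2 hr)) hc, q, hq, by
        rw [NNReal.smul_def, smul_smul]⟩

/-! ### The norm `p`, its dual, and nearest points -/

theorem seminorm_continuous (p : Seminorm ℝ (Fin n → ℝ)) : Continuous p :=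
  continuousOn_univ.1 (p.convexOn.continuousOn isOpen_univ)

theorem exists_mul_norm_le (p : Seminorm ℝ (Fin n → ℝ)) (hp : ∀ x, p x = 0 → x = 0) :
    ∃ c > 0, ∀ x, c * ‖x‖ ≤ p x := by
  -- The sphere is empty when n = 0; otherwise c is the minimum of p on it.
  rcases (Metric.sphere (0 : Fin n → ℝ) 1).eq_empty_or_nonempty with he | hne
  · refine ⟨1, one_pos, fun x => ?_⟩
    have hx : x = 0 := by
      by_contra hx
      refine Set.eq_empty_iff_forall_notMem.1 he (‖x‖⁻¹ • x) ?_
      rw [mem_sphere_zero_iff_norm, norm_smul, norm_inv, norm_norm,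
        inv_mul_cancel₀ (norm_ne_zero_iff.2 hx)]
    simp [hx]
  · obtain ⟨s, hs, hmin⟩ := (isCompact_sphere (0 : Fin n → ℝ) 1).exists_isMinOn hne
      (seminorm_continuous p).continuousOn
    have hs0 : s ≠ 0 := by
      rintro rfl
      simp at hs
    refine ⟨p s, lt_of_le_of_ne (apply_nonneg p s) fun h => hs0 (hp s h.symm), fun x => ?_⟩
    rcases eq_or_ne x 0 with rfl | hx
    · simp
    have hx' : 0 < ‖x‖ := norm_pos_iff.2 hx
    have h1 : p s ≤ p (‖x‖⁻¹ • x) := hmin (by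
      rw [mem_sphere_zero_iff_norm, norm_smul, norm_inv, norm_norm, inv_mul_cancel₀ hx'.ne'])
    rw [map_smul_eq_mul, norm_inv, norm_norm, inv_mul_eq_div, le_div_iff₀ hx'] at h1
    exact h1

theorem abs_dotProduct_le (u x : Fin n → ℝ) : |u ⬝ᵥ x| ≤ n * ‖u‖ * ‖x‖ := by
  calc |u ⬝ᵥ x| ≤ ∑ i, |u i * x i| := Finset.abs_sum_le_sum_abs _ _
    _ ≤ ∑ _i : Fin n, ‖u‖ * ‖x‖ := Finset.sum_le_sum fun i _ => by
        rw [abs_mul]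
        exact mul_le_mul (norm_le_pi_norm u i) (norm_le_pi_norm x i) (abs_nonneg _) (norm_nonneg _)
    _ = n * ‖u‖ * ‖x‖ := by simp [mul_assoc]

/-- The dual norm as a real number. -/
noncomputable def dualNormReal (p : Seminorm ℝ (Fin n → ℝ)) (u : Fin n → ℝ) : ℝ :=
  (dualNorm p u).toReal

theorem dualNormReal_nonneg (p : Seminorm ℝ (Fin n → ℝ)) (u : Fin n → ℝ) :
    0 ≤ dualNormReal p u := ENNReal.toReal_nonneg

theorem dualNorm_le {p : Seminorm ℝ (Fin n → ℝ)} {u : Fin n → ℝ} {B : ℝ}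
    (h : ∀ x, p x ≤ 1 → |u ⬝ᵥ x| ≤ B) : dualNorm p u ≤ ENNReal.ofReal B :=
  iSup₂_le fun x hx => ENNReal.ofReal_le_ofReal (h x hx)

theorem dualNormReal_le {p : Seminorm ℝ (Fin n → ℝ)} {u : Fin n → ℝ} {B : ℝ} (hB : 0 ≤ B)
    (h : ∀ x, p x ≤ 1 → |u ⬝ᵥ x| ≤ B) : dualNormReal p u ≤ B :=
  ENNReal.toReal_le_of_le_ofReal hB (dualNorm_le h)

theorem dualNorm_neg (p : Seminorm ℝ (Fin n → ℝ)) (u : Fin n → ℝ) :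
    dualNorm p (-u) = dualNorm p u := by
  simp only [dualNorm, neg_dotProduct, abs_neg]

theorem exists_abs_dotProduct_le {p : Seminorm ℝ (Fin n → ℝ)} (hp : ∀ x, p x = 0 → x = 0)
    : ∃ C : ℝ, 0 ≤ C ∧ ∀ u x, p x ≤ 1 → |u ⬝ᵥ x| ≤ C * ‖u‖ := by
  obtain ⟨c, hc, h⟩ := exists_mul_norm_le p hp
  refine ⟨n / c, by positivity, fun u x hx => (abs_dotProduct_le u x).trans ?_⟩
  have h1 : ‖x‖ ≤ 1 / c := by
    rw [le_div_iff₀ hc]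
    linarith [h x]
  calc n * ‖u‖ * ‖x‖ ≤ n * ‖u‖ * (1 / c) := by gcongr
    _ = n / c * ‖u‖ := by ring

theorem dualNorm_ne_top {p : Seminorm ℝ (Fin n → ℝ)} (hp : ∀ x, p x = 0 → x = 0)
    (u : Fin n → ℝ) : dualNorm p u ≠ ∞ := by
  obtain ⟨C, _, h⟩ := exists_abs_dotProduct_le hp
  exact ne_top_of_le_ne_top ENNReal.ofReal_ne_top (dualNorm_le (h u))

theorem abs_dotProduct_le_dualNormReal {p : Seminorm ℝ (Fin n → ℝ)} (hp : ∀ x, p x = 0 → x = 0)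
    (u x : Fin n → ℝ) :
    |u ⬝ᵥ x| ≤ dualNormReal p u * p x := by
  have hunit : ∀ y, p y ≤ 1 → |u ⬝ᵥ y| ≤ dualNormReal p u := fun y hy =>
    (ENNReal.ofReal_le_iff_le_toReal (dualNorm_ne_top hp u)).1
      (le_iSup₂ (f := fun (x : Fin n → ℝ) (_ : p x ≤ 1) => ENNReal.ofReal |u ⬝ᵥ x|) y hy)
  rcases (apply_nonneg p x).eq_or_lt with h0 | h0
  · rw [hp x h0.symm]
    simp
  · have h1 := hunit ((p x)⁻¹ • x) (by
      rw [map_smul_eq_mul, norm_inv, Real.norm_eq_abs, abs_of_pos h0, inv_mul_cancel₀ h0.ne'])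
    rw [dotProduct_smul, smul_eq_mul, abs_mul, abs_inv, abs_of_pos h0, inv_mul_eq_div,
      div_le_iff₀ h0] at h1
    exact h1

theorem dotProduct_le_dualNormReal {p : Seminorm ℝ (Fin n → ℝ)} (hp : ∀ x, p x = 0 → x = 0)
    (u x : Fin n → ℝ) : u ⬝ᵥ x ≤ dualNormReal p u * p x :=
  (le_abs_self _).trans (abs_dotProduct_le_dualNormReal hp u x)

theorem dualNormReal_smul_le {p : Seminorm ℝ (Fin n → ℝ)} (hp : ∀ x, p x = 0 → x = 0)
    {c : ℝ} (hc : 0 < c) (u : Fin n → ℝ) :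
    c * dualNormReal p u ≤ dualNormReal p (c • u) := by
  have h : dualNormReal p u ≤ dualNormReal p (c • u) / c := by
    refine dualNormReal_le (div_nonneg (dualNormReal_nonneg _ _) hc.le) fun x hx => ?_
    have h1 := abs_dotProduct_le_dualNormReal hp (c • u) x
    rw [smul_dotProduct, smul_eq_mul, abs_mul, abs_of_pos hc] at h1
    rw [le_div_iff₀ hc]
    nlinarith [dualNormReal_nonneg p (c • u)]
  rw [le_div_iff₀ hc] at h
  linarith

/-- Subadditivity and the bound by C‖·‖ make the dual norm Lipschitz. Continuity lets dual-norm
estimates pass to limits of cone elements. -/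
theorem continuous_dualNormReal {p : Seminorm ℝ (Fin n → ℝ)} (hp : ∀ x, p x = 0 → x = 0)
    : Continuous (dualNormReal p) := by
  obtain ⟨C, hC, h⟩ := exists_abs_dotProduct_le hp
  have hle : ∀ u v, dualNormReal p u ≤ dualNormReal p v + C * ‖u - v‖ := fun u v =>
    dualNormReal_le (add_nonneg (dualNormReal_nonneg _ _) (by positivity)) fun x hx => by
      have h1 := abs_dotProduct_le_dualNormReal hp v x
      have h2 := h (u - v) x hx
      have h3 : u ⬝ᵥ x = v ⬝ᵥ x + (u - v) ⬝ᵥ x := by rw [sub_dotProduct]; ring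
      rw [h3]
      have h4 := abs_add_le (v ⬝ᵥ x) ((u - v) ⬝ᵥ x)
      nlinarith [dualNormReal_nonneg p v]
  refine (LipschitzWith.of_dist_le_mul (K := C.toNNReal) fun u v => ?_).continuous
  rw [Real.dist_eq, dist_eq_norm, abs_sub_le_iff, Real.coe_toNNReal C hC]
  have h1 := hle u v
  have h2 := hle v u
  rw [norm_sub_rev] at h2
  exact ⟨by linarith, by linarith⟩

/-- A bound on the dual norm over all exposed faces of `conv S` not containing `0` gives a bound
over the closed cone generated by `S`. -/
theorem dotProduct_le_of_mem_closure_cone {p : Seminorm ℝ (Fin n → ℝ)} (hp : ∀ x, p x = 0 → x = 0)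
    {S : Set (Fin n → ℝ)} (hS : IsCompact S) {κ M : ℝ}
    (hM : 0 ≤ M)
    (hκ : ∀ d : Fin n → ℝ, (∀ s ∈ S, s ⬝ᵥ d ≤ 1) →
      ∀ q ∈ convexHull ℝ {s ∈ S | s ⬝ᵥ d = 1}, 1 ≤ κ * dualNormReal p q)
    {z : Fin n → ℝ} (hz : ∀ s ∈ S, s ⬝ᵥ z ≤ M) {u : Fin n → ℝ}
    (hu : u ∈ closure (Submodule.span ℝ≥0 S : Set (Fin n → ℝ))) (hκ0 : 0 ≤ κ) :
    u ⬝ᵥ z ≤ κ * dualNormReal p u * M := by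
  -- G is closed, so it suffices to treat the face cones, where v is 0 or cq with q'z ≤ M and 1 ≤
  -- κ‖q‖_*.
  let G : Set (Fin n → ℝ) := {v | v ⬝ᵥ z ≤ κ * dualNormReal p v * M}
  have hcont := continuous_dualNormReal hp
  have hG : IsClosed G := isClosed_le (by fun_prop) (by fun_prop)
  refine hG.closure_subset_iff.2 (fun v hv => mem_of_mem_cone hS hG (fun d hd w hw => ?_) hv) hu
  rcases exists_smul_of_mem_span hw with rfl | ⟨c, hc, q, hq, rfl⟩
  · change (0 : Fin n → ℝ) ⬝ᵥ z ≤ _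
    rw [zero_dotProduct]
    exact mul_nonneg (mul_nonneg hκ0 (dualNormReal_nonneg _ _)) hM
  · have hqz : q ⬝ᵥ z ≤ M := by
      have hconv : Convex ℝ {s : Fin n → ℝ | s ⬝ᵥ z ≤ M} := fun x hx y hy α β hα hβ hαβ => by
        simp only [Set.mem_ofPred_eq, add_dotProduct, smul_dotProduct, smul_eq_mul] at *
        nlinarith
      exact convexHull_min (fun s hs => hz s hs.1) hconv hq
    have h1 := hκ d hd q hq
    have h2 := dualNormReal_smul_le hp hc q
    change (c • q) ⬝ᵥ z ≤ _
    rw [smul_dotProduct, smul_eq_mul]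
    calc c * (q ⬝ᵥ z) ≤ c * M := by gcongr
      _ ≤ c * M * (κ * dualNormReal p q) := le_mul_of_one_le_right (by positivity) h1
      _ = κ * (c * dualNormReal p q) * M := by ring
      _ ≤ κ * dualNormReal p (c • q) * M := by gcongr

/-- Nearest points in closed convex sets, with a normal vector that attains the distance. -/
theorem exists_nearest_point_normal {p : Seminorm ℝ (Fin n → ℝ)} (hp : ∀ x, p x = 0 → x = 0)
    {F : Set (Fin n → ℝ)} (hne : F.Nonempty) (hcl : IsClosed F)
    (hconv : Convex ℝ F) {x : Fin n → ℝ} (hx : x ∉ F) :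
    ∃ y ∈ F, ∃ u : Fin n → ℝ, (∀ z ∈ F, u ⬝ᵥ (z - y) ≤ 0) ∧ 0 < dualNormReal p u ∧
      dualNormReal p u * p (x - y) ≤ u ⬝ᵥ (x - y) := by
  obtain ⟨c, hc, hpc⟩ := exists_mul_norm_le p hp
  have hpcont := seminorm_continuous p
  obtain ⟨z0, hz0⟩ := hne
  have hK : IsCompact (F ∩ {z | p (x - z) ≤ p (x - z0)}) := by
    refine Metric.isCompact_of_isClosed_isBounded
      (hcl.inter (isClosed_le (by fun_prop) continuous_const)) ?_
    refine (Metric.isBounded_closedBall (x := x) (r := p (x - z0) / c)).subset fun z hz => ?_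
    rw [Metric.mem_closedBall, dist_comm, dist_eq_norm, le_div_iff₀ hc]
    have h2 : p (x - z) ≤ p (x - z0) := hz.2
    linarith [hpc (x - z)]
  obtain ⟨y, hy, hmin⟩ := hK.exists_isMinOn ⟨z0, hz0, le_refl (p (x - z0))⟩
    (f := fun z => p (x - z)) (by fun_prop)
  have hmin' : ∀ z ∈ F, p (x - y) ≤ p (x - z) := fun z hz => by
    by_cases h : p (x - z) ≤ p (x - z0)
    · exact hmin ⟨hz, h⟩
    · exact hy.2.trans (not_le.1 h).le
  set r := p (x - y) with hr
  have hr0 : 0 < r := lt_of_le_of_ne (apply_nonneg _ _) fun h =>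
    hx (by rw [sub_eq_zero.1 (hp _ h.symm)]; exact hy.1)
  have hBconv : Convex ℝ {z | p (x - z) < r} := by
    have h := p.convex_ball x r
    refine (congrArg (Convex ℝ) (Set.ext fun z => ?_)).mp h
    rw [p.mem_ball, map_sub_rev]
    rfl
  obtain ⟨f, γ, hf1, hf2⟩ := geometric_hahn_banach_open hBconv
    (isOpen_lt (by fun_prop) continuous_const) hconv
    (Set.disjoint_left.2 fun z hz hzF => absurd hz (not_lt.2 (hmin' z hzF)))
  -- f separates the open p-ball of radius r about x from F, being smaller on the ball; the sign
  -- makes u an outward normal.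
  set u : Fin n → ℝ := fun i => -f (Pi.single i 1) with hu
  have hfu : ∀ z, u ⬝ᵥ z = -f z := fun z => by
    conv_rhs => rw [← Finset.univ_sum_single z]
    rw [map_sum, dotProduct, ← Finset.sum_neg_distrib]
    refine Finset.sum_congr rfl fun i _ => ?_
    have : Pi.single i (z i) = z i • (Pi.single i 1 : Fin n → ℝ) := by
      rw [← Pi.single_smul', smul_eq_mul, mul_one]
    rw [this, map_smul, smul_eq_mul, hu]
    ring
  -- Passing to the closed ball yields both f y = γ and the bound on the dual norm of u.
  have hball : ∀ v, p v ≤ r → f x + f v ≤ γ := fun v hv => by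
    have hlim : Filter.Tendsto (fun s : ℝ => f x + s * f v) (𝓝[<] 1) (𝓝 (f x + f v)) := by
      have : Continuous fun s : ℝ => f x + s * f v := by fun_prop
      simpa using this.continuousWithinAt (s := Set.Iio 1) (x := 1) |>.tendsto
    refine le_of_tendsto hlim ?_
    filter_upwards [Ioo_mem_nhdsLT (zero_lt_one' ℝ)] with s hs
    have := hf1 (x + s • v) (by
      change p (x - (x + s • v)) < r
      rw [sub_add_cancel_left, map_neg_eq_map, map_smul_eq_mul, Real.norm_eq_abs,
        abs_of_pos hs.1]
      have := hs.1
      have := hs.2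
      nlinarith)
    rw [map_add, map_smul, smul_eq_mul] at this
    exact this.le
  have hyγ : f y = γ := le_antisymm
    (by simpa using hball (y - x) (by rw [map_sub_rev])) (hf2 y hy.1)
  have hmain : dualNormReal p u ≤ u ⬝ᵥ (x - y) / r := by
    have hle : ∀ v, p v ≤ 1 → -(u ⬝ᵥ v) ≤ u ⬝ᵥ (x - y) / r := fun v hv => by
      have := hball (r • v) (by
        rw [map_smul_eq_mul, Real.norm_eq_abs, abs_of_pos hr0]
        nlinarith)
      rw [map_smul, smul_eq_mul] at this
      rw [le_div_iff₀ hr0, hfu, hfu, map_sub, hyγ]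
      linarith
    refine dualNormReal_le ?_ fun v hv => abs_le.2 ⟨by linarith [hle v hv], ?_⟩
    · simpa using hle 0 (by simp)
    · have := hle (-v) (by rwa [map_neg_eq_map])
      rwa [dotProduct_neg, neg_neg] at this
  rw [le_div_iff₀ hr0] at hmain
  refine ⟨y, hy.1, u, fun z hz => ?_, ?_, hmain⟩
  · rw [hfu, map_sub, hyγ]
    linarith [hf2 z hz]
  · have hxy : f x < γ := hf1 x (by simpa using hr0)
    have h1 := dotProduct_le_dualNormReal hp u (x - y)
    have h2 : 0 < u ⬝ᵥ (x - y) := by rw [hfu, map_sub, hyγ]; linarith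
    by_contra hcon
    have h3 : dualNormReal p u = 0 := le_antisymm (not_lt.1 hcon) (dualNormReal_nonneg _ _)
    rw [h3, zero_mul] at h1
    linarith

/-! ### Feasible sets under local polyhedrality -/

variable {T : Type*} [TopologicalSpace T]

theorem isClosed_feasibleSet (a : C(T, Fin n → ℝ)) (b : C(T, ℝ)) : IsClosed (feasibleSet a b) := by
  have : feasibleSet a b = ⋂ t, {x | a t ⬝ᵥ x ≤ b t} := by
    ext
    simp [feasibleSet]
  rw [this]
  exact isClosed_iInter fun t => isClosed_le (by fun_prop) continuous_const

theorem convex_feasibleSet (a : C(T, Fin n → ℝ)) (b : C(T, ℝ)) : Convex ℝ (feasibleSet a b) := by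
  intro x hx y hy α β hα hβ hαβ t
  rw [dotProduct_add, dotProduct_smul, dotProduct_smul, smul_eq_mul, smul_eq_mul]
  calc α * (a t ⬝ᵥ x) + β * (a t ⬝ᵥ y) ≤ α * b t + β * b t := by gcongr <;> [exact hx t; exact hy t]
    _ = b t := by rw [← add_mul, hαβ, one_mul]

theorem isCompact_image_activeIndices [CompactSpace T] (a : C(T, Fin n → ℝ)) (b : C(T, ℝ))
    (x : Fin n → ℝ) : IsCompact (a '' activeIndices a b x) := by
  have : IsClosed (activeIndices a b x) :=
    isClosed_eq (a.continuous.dotProduct continuous_const) b.continuous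
  exact this.isCompact.image a.continuous

/-- Under local polyhedrality, a direction that makes a nonpositive product with every active
coefficient vector is feasible. -/
theorem IsLOP.mem_feasibleDirections {a : C(T, Fin n → ℝ)} {b : C(T, ℝ)} (h : IsLOP a b)
    {x : Fin n → ℝ} (hx : x ∈ feasibleSet a b) {w : Fin n → ℝ}
    (hw : ∀ t ∈ activeIndices a b x, a t ⬝ᵥ w ≤ 0) :
    w ∈ feasibleDirections (feasibleSet a b) x := by
  rw [h x hx]
  intro v hv
  rw [dotProduct_comm]
  exact dotProduct_nonpos_of_mem_span (by rintro _ ⟨t, ht, rfl⟩; exact hw t ht) hv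

/-- Under local polyhedrality, the normal cone of the feasible set is the closure of the active
cone. -/
theorem IsLOP.normal_mem_closure_activeCone {a : C(T, Fin n → ℝ)} {b : C(T, ℝ)} (h : IsLOP a b)
    {x : Fin n → ℝ} (hx : x ∈ feasibleSet a b) {u : Fin n → ℝ}
    (hu : ∀ z ∈ feasibleSet a b, u ⬝ᵥ (z - x) ≤ 0) : u ∈ closure (activeCone a b x) := by
  by_contra hcon
  obtain ⟨w, hw, hK⟩ := exists_separation_of_notMem_closure _ hcon
  obtain ⟨ε, hε, hfeas⟩ := h.mem_feasibleDirections hx fun t ht =>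
    hK _ (Submodule.subset_span ⟨t, ht, rfl⟩)
  have h1 := hu _ (hfeas ε ⟨hε.le, le_rfl⟩)
  rw [add_sub_cancel_left, dotProduct_smul, smul_eq_mul] at h1
  linarith [mul_pos hε hw]

/-! ### Extreme points and active indices -/

theorem eq_zero_of_mem_span_of_forall_dotProduct {ι : Type*} {f : ι → Fin n → ℝ} {w : Fin n → ℝ}
    (hw : w ∈ Submodule.span ℝ (Set.range f)) (h : ∀ i, f i ⬝ᵥ w = 0) : w = 0 := by
  rw [← dotProduct_self_eq_zero]
  have : ∀ v ∈ Submodule.span ℝ (Set.range f), v ⬝ᵥ w = 0 := fun v hv => by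
    induction hv using Submodule.span_induction with
    | mem x hx => obtain ⟨i, rfl⟩ := hx; exact h i
    | zero => simp
    | add x y _ _ hx hy => rw [add_dotProduct, hx, hy, add_zero]
    | smul c x _ hx => rw [smul_dotProduct, hx, smul_zero]
  exact this w hw

/-- Every feasible point can be moved into the span of the coefficient vectors without changing
the values of the constraints. -/
theorem exists_mem_span_dotProduct_eq (a : C(T, Fin n → ℝ)) (x : Fin n → ℝ) :
    ∃ y ∈ Submodule.span ℝ (Set.range a), ∀ t, a t ⬝ᵥ y = a t ⬝ᵥ x := by
  set V := Submodule.span ℝ (Set.range a) with hV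
  obtain ⟨y, hy, hproj⟩ := exists_projection (P := (V : Set (Fin n → ℝ))) ⟨0, V.zero_mem⟩
    V.closed_of_finiteDimensional V.convex x
  refine ⟨y, hy, fun t => ?_⟩
  have ht : a t ∈ V := Submodule.subset_span ⟨t, rfl⟩
  have h1 := hproj _ (V.add_mem hy ht)
  have h2 := hproj _ (V.sub_mem hy ht)
  rw [add_sub_cancel_left, dotProduct_comm, dotProduct_sub] at h1
  rw [sub_sub_cancel_left, dotProduct_neg, dotProduct_comm, dotProduct_sub] at h2
  linarith

/-- Moving along a direction that is orthogonal to the active coefficient vectors and increases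
some constraint leads to a feasible point with a strictly larger active span. -/
theorem IsLOP.exists_activeSpan_lt {a : C(T, Fin n → ℝ)} {b : C(T, ℝ)} (h : IsLOP a b)
    {x : Fin n → ℝ} (hx : x ∈ feasibleSet a b) {w : Fin n → ℝ}
    (hw : ∀ t ∈ activeIndices a b x, a t ⬝ᵥ w = 0) {t₀ : T} (ht₀ : 0 < a t₀ ⬝ᵥ w) :
    ∃ s : ℝ, x + s • w ∈ feasibleSet a b ∧
      activeIndices a b x ⊆ activeIndices a b (x + s • w) ∧
      Submodule.span ℝ (a '' activeIndices a b x) <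
        Submodule.span ℝ (a '' activeIndices a b (x + s • w)) := by
  let I : Set ℝ := {s | x + s • w ∈ feasibleSet a b} ∩ Set.Ici 0
  have hIcl : IsClosed I :=
    ((isClosed_feasibleSet a b).preimage (by fun_prop)).inter isClosed_Ici
  have hIbd : I ⊆ Set.Icc 0 ((b t₀ - a t₀ ⬝ᵥ x) / (a t₀ ⬝ᵥ w)) := fun s hs => by
    refine ⟨hs.2, ?_⟩
    have h1 : a t₀ ⬝ᵥ (x + s • w) ≤ b t₀ := hs.1 t₀
    rw [dotProduct_add, dotProduct_smul, smul_eq_mul] at h1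
    rw [le_div_iff₀ ht₀]
    linarith
  have hIne : I.Nonempty := ⟨0, by simpa using hx, Set.self_mem_Ici⟩
  obtain ⟨s, hs, hmax⟩ := (isCompact_Icc.of_isClosed_subset hIcl hIbd).exists_isGreatest hIne
  have hsub : activeIndices a b x ⊆ activeIndices a b (x + s • w) := fun t ht => by
    have h1 : a t ⬝ᵥ x = b t := ht
    change a t ⬝ᵥ (x + s • w) = b t
    rw [dotProduct_add, dotProduct_smul, hw t ht, h1, smul_zero, add_zero]
  refine ⟨s, hs.1, hsub, lt_of_le_of_ne (Submodule.span_mono (Set.image_mono hsub)) fun heq => ?_⟩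
  -- If no active constraint blocked w at the last feasible step s, local polyhedrality would permit
  -- a longer step.
  have hex : ∃ t ∈ activeIndices a b (x + s • w), 0 < a t ⬝ᵥ w := by
    by_contra! hcon
    obtain ⟨ε, hε, hfeas⟩ := h.mem_feasibleDirections hs.1 hcon
    have h1 := hfeas ε ⟨hε.le, le_rfl⟩
    rw [add_assoc, ← add_smul] at h1
    have h2 : s + ε ≤ s := hmax ⟨h1, add_nonneg hs.2 hε.le⟩
    linarith
  obtain ⟨t, ht, htw⟩ := hex
  have hmem : a t ∈ Submodule.span ℝ (a '' activeIndices a b x) := by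
    rw [heq]
    exact Submodule.subset_span ⟨t, ht, rfl⟩
  have hzero : ∀ v ∈ Submodule.span ℝ (a '' activeIndices a b x), v ⬝ᵥ w = 0 := fun v hv => by
    induction hv using Submodule.span_induction with
    | mem v hv => obtain ⟨t, ht, rfl⟩ := hv; exact hw t ht
    | zero => simp
    | add x y _ _ hx hy => rw [add_dotProduct, hx, hy, add_zero]
    | smul c x _ hx => rw [smul_dotProduct, hx, smul_zero]
  linarith [hzero _ hmem]

/-- For every feasible point there is an extreme point at which all its active constraints are
active. -/
theorem IsLOP.exists_mem_extremeSet {a : C(T, Fin n → ℝ)} {b : C(T, ℝ)} (h : IsLOP a b)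
    {x : Fin n → ℝ} (hx : x ∈ feasibleSet a b) :
    ∃ e ∈ extremeSet a b, activeIndices a b x ⊆ activeIndices a b e := by
  set V := Submodule.span ℝ (Set.range a) with hV
  let Y : Set (Fin n → ℝ) :=
    {y | y ∈ feasibleSet a b ∧ y ∈ V ∧ activeIndices a b x ⊆ activeIndices a b y}
  obtain ⟨y, hyV, hy⟩ := exists_mem_span_dotProduct_eq a x
  have hyY : y ∈ Y := ⟨fun t => (hy t).trans_le (hx t), hyV, fun t ht => (hy t).trans ht⟩
  -- The maximal active span exists by finite dimension, even for infinite T. Maximality forbids the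
  -- move of `IsLOP.exists_activeSpan_lt`; applied to both signs of x₂ - x₁, this gives extremality.
  obtain ⟨W, ⟨⟨e, heY, rfl⟩, hmax⟩⟩ := WellFoundedGT.exists_maximal inferInstance
    ((fun y => Submodule.span ℝ (a '' activeIndices a b y)) '' Y) ⟨_, y, hyY, rfl⟩
  have hno : ∀ w ∈ V, (∀ t ∈ activeIndices a b e, a t ⬝ᵥ w = 0) → ∀ t, a t ⬝ᵥ w ≤ 0 := by
    intro w hwV hw t
    by_contra! hcon
    obtain ⟨s, hs1, hs2, hlt⟩ := h.exists_activeSpan_lt heY.1 hw hcon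
    exact hlt.not_ge (hmax ⟨_, ⟨hs1, V.add_mem heY.2.1 (V.smul_mem s hwV),
      heY.2.2.trans hs2⟩, rfl⟩ hlt.le)
  refine ⟨e, mem_extremePoints.2 ⟨⟨heY.1, heY.2.1⟩, fun x₁ hx₁ x₂ hx₂ hseg => ?_⟩, heY.2.2⟩
  have hact : ∀ t ∈ activeIndices a b e, a t ⬝ᵥ (x₂ - x₁) = 0 := by
    intro t ht
    obtain ⟨α, β, hα, hβ, hαβ, rfl⟩ := hseg
    have h0 : a t ⬝ᵥ (α • x₁ + β • x₂) = b t := ht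
    have h1 : a t ⬝ᵥ x₁ ≤ b t := hx₁.1 t
    have h2 : a t ⬝ᵥ x₂ ≤ b t := hx₂.1 t
    rw [dotProduct_add, dotProduct_smul, dotProduct_smul, smul_eq_mul, smul_eq_mul] at h0
    have h3 : α * (b t - a t ⬝ᵥ x₁) + β * (b t - a t ⬝ᵥ x₂) = 0 := by
      linear_combination b t * hαβ - h0
    have h4 := mul_nonneg hα.le (sub_nonneg.2 h1)
    have h5 := mul_nonneg hβ.le (sub_nonneg.2 h2)
    have h6 := (mul_eq_zero.1 (by linarith : α * (b t - a t ⬝ᵥ x₁) = 0)).resolve_left hα.ne'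
    have h7 := (mul_eq_zero.1 (by linarith : β * (b t - a t ⬝ᵥ x₂) = 0)).resolve_left hβ.ne'
    rw [dotProduct_sub]
    linarith
  have hwV : x₂ - x₁ ∈ V := V.sub_mem hx₂.2 hx₁.2
  have heq : x₂ - x₁ = 0 := eq_zero_of_mem_span_of_forall_dotProduct hwV fun t => by
    have h1 := hno _ hwV hact t
    have h2 := hno _ (V.neg_mem hwV) (fun t ht => by rw [dotProduct_neg, hact t ht, neg_zero]) t
    rw [dotProduct_neg] at h2
    linarith
  obtain rfl : x₂ = x₁ := sub_eq_zero.1 heq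
  rw [openSegment_same] at hseg
  exact ⟨hseg.symm, hseg.symm⟩

/-- An extreme point is determined by its active indices. -/
theorem IsLOP.activeIndices_injOn {a : C(T, Fin n → ℝ)} {b : C(T, ℝ)} (h : IsLOP a b) :
    Set.InjOn (activeIndices a b) (extremeSet a b) := by
  intro e he e' he' heq
  have hact : ∀ t ∈ activeIndices a b e, a t ⬝ᵥ (e - e') = 0 := fun t ht => by
    have h1 : a t ⬝ᵥ e = b t := ht
    have h2 : t ∈ activeIndices a b e' := heq ▸ ht
    change a t ⬝ᵥ e' = b t at h2
    rw [dotProduct_sub, h1, h2, sub_self]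
  obtain ⟨ε, hε, hfeas⟩ := h.mem_feasibleDirections he.1.1 fun t ht => (hact t ht).le
  have hmem : e + ε • (e - e') ∈ feasibleSet a b ∩
      (Submodule.span ℝ (Set.range a) : Set (Fin n → ℝ)) :=
    ⟨hfeas ε ⟨hε.le, le_rfl⟩, Submodule.add_mem _ he.1.2
      (Submodule.smul_mem _ _ (Submodule.sub_mem _ he.1.2 he'.1.2))⟩
  -- With these weights e lies strictly between e' and e + ε(e - e'), so extremality forces e' = e.
  refine ((mem_extremePoints.1 he).2 _ he'.1 _ hmem
    ⟨ε / (1 + ε), 1 / (1 + ε), by positivity, by positivity, by field_simp; ring, ?_⟩).1.symm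
  ext i
  simp only [Pi.add_apply, Pi.smul_apply, Pi.sub_apply, smul_eq_mul]
  field_simp
  ring

theorem empty_mem_hyperplaneFamily (a : C(T, Fin n → ℝ)) (b : C(T, ℝ)) (x : Fin n → ℝ) :
    ∅ ∈ hyperplaneFamily a b x :=
  ⟨Set.empty_subset _, 0, fun _ ht => ht.elim, fun t _ => by simp⟩

/-! ### Distances for `p` and in the parameter space -/

theorem edist_normMetric (p : Seminorm ℝ (Fin n → ℝ)) (x y : Fin n → ℝ) :
    @edist _ (normMetric p).toEDist x y = ENNReal.ofReal (p (x - y)) := by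
  have h : @dist _ (normMetric p).toDist y x = p (-y + x) := rfl
  rw [@edist_comm _ (normMetric p).toPseudoEMetricSpace, @edist_dist _ (normMetric p), h,
    sub_eq_neg_add]

theorem infEDist_normMetric_le {p : Seminorm ℝ (Fin n → ℝ)} {F : Set (Fin n → ℝ)}
    {x y : Fin n → ℝ} (hy : y ∈ F) :
    @Metric.infEDist _ (normMetric p).toPseudoEMetricSpace x F ≤ ENNReal.ofReal (p (x - y)) := by
  rw [← edist_normMetric]
  exact @Metric.infEDist_le_edist_of_mem _ (normMetric p).toPseudoEMetricSpace _ _ _ hy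

theorem le_infEDist_normMetric {p : Seminorm ℝ (Fin n → ℝ)} {F : Set (Fin n → ℝ)}
    {x : Fin n → ℝ} {r : ℝ} (h : ∀ y ∈ F, r ≤ p (x - y)) :
    ENNReal.ofReal r ≤ @Metric.infEDist _ (normMetric p).toPseudoEMetricSpace x F := by
  refine (@Metric.le_infEDist _ (normMetric p).toPseudoEMetricSpace _ _ _).2 fun y hy => ?_
  rw [edist_normMetric]
  exact ENNReal.ofReal_le_ofReal (h y hy)

variable [CompactSpace T]

theorem infEDist_feasible_parameters_le {a : C(T, Fin n → ℝ)} {b : C(T, ℝ)} {x : Fin n → ℝ}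
    {M : ℝ} (hM : 0 ≤ M) (h : ∀ t, a t ⬝ᵥ x ≤ b t + M) :
    Metric.infEDist b {b' | x ∈ feasibleSet a b'} ≤ ENNReal.ofReal M := by
  have hmem : b + ContinuousMap.const T M ∈ {b' | x ∈ feasibleSet a b'} := h
  refine (Metric.infEDist_le_edist_of_mem hmem).trans ?_
  rw [edist_dist]
  refine ENNReal.ofReal_le_ofReal ((ContinuousMap.dist_le hM).2 fun t => ?_)
  simp [abs_of_nonneg hM]

/-! ### The cycle of inequalities -/

theorem clmF_le_hofF (p : Seminorm ℝ (Fin n → ℝ)) (a : C(T, Fin n → ℝ)) (b : C(T, ℝ))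
    (x : Fin n → ℝ) : clmF p a b x ≤ hofF p a b :=
  le_iInf₂ fun κ hκ => iInf₂_le κ (Filter.Eventually.of_forall hκ)

/-- For q ∈ conv {a_t : t ∈ D}, q'd = 1 and q'(e - y) ≥ 0 for feasible y, so e + sd is at distance
at least s/‖q‖_* from the feasible set. Its violation is at most s(1 + δ) for small s > 0; then δ →
0. -/
theorem inv_dualDist_le_clmF {p : Seminorm ℝ (Fin n → ℝ)} (hp : ∀ x, p x = 0 → x = 0)
    {a : C(T, Fin n → ℝ)} {b : C(T, ℝ)} {e : Fin n → ℝ} (he : e ∈ feasibleSet a b) {D : Set T}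
    (hD : D ∈ hyperplaneFamily a b e) :
    (dualDist p 0 (convexHull ℝ (a '' D)))⁻¹ ≤ clmF p a b e := by
  refine le_iInf₂ fun κ hκ => ENNReal.inv_le_iff_inv_le.2 (le_iInf₂ fun q hq => ?_)
  obtain ⟨hDT, d, hd1, hd2⟩ := hD
  have hact : ∀ t ∈ activeIndices a b e, a t ⬝ᵥ d ≤ 1 := fun t ht => by
    by_cases h : t ∈ D
    · exact (hd1 t h).le
    · exact (hd2 t ⟨ht, h⟩).le
  have hq' : ∀ y ∈ feasibleSet a b, q ⬝ᵥ (e - y) ≥ 0 ∧ q ⬝ᵥ d = 1 := fun y hy => by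
    have hconv : Convex ℝ {s : Fin n → ℝ | s ⬝ᵥ (e - y) ≥ 0 ∧ s ⬝ᵥ d = 1} := by
      rintro s ⟨hs1, hs2⟩ s' ⟨hs1', hs2'⟩ α β hα hβ hαβ
      simp only [Set.mem_ofPred_eq, add_dotProduct, smul_dotProduct, smul_eq_mul]
      exact ⟨add_nonneg (mul_nonneg hα hs1) (mul_nonneg hβ hs1'), by rw [hs2, hs2']; linarith⟩
    refine convexHull_min ?_ hconv hq
    rintro _ ⟨t, ht, rfl⟩
    have h1 : a t ⬝ᵥ e = b t := hDT ht
    have h2 : a t ⬝ᵥ y ≤ b t := hy t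
    exact ⟨by rw [dotProduct_sub]; linarith, hd1 t ht⟩
  have hpos : ∀ y ∈ feasibleSet a b, ∀ s : ℝ, s ≤ dualNormReal p q * p (e + s • d - y) :=
    fun y hy s => by
      have h1 := dotProduct_le_dualNormReal hp q (e + s • d - y)
      obtain ⟨h2, h3⟩ := hq' y hy
      have h4 : e + s • d - y = (e - y) + s • d := by abel
      have h5 : q ⬝ᵥ (e + s • d - y) = q ⬝ᵥ (e - y) + s := by
        rw [h4, dotProduct_add, dotProduct_smul, h3, smul_eq_mul, mul_one]
      linarith
  have hN : 0 < dualNormReal p q := by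
    refine lt_of_le_of_ne (dualNormReal_nonneg p q) fun h => ?_
    have := hpos e he 1
    rw [← h, zero_mul] at this
    linarith
  -- Inactive t may have a_t'd > 1 while being nearly active. The slack δ gives strict inequality on
  -- active indices, so compactness yields one step bound r for all t.
  have hreal : ∀ δ > 0, 1 / dualNormReal p q ≤ κ * (1 + δ) := fun δ hδ => by
    obtain ⟨r, hr, hfeas⟩ := exists_pos_add_mul_nonpos (isCompact_univ (X := T))
      (g := fun t => a t ⬝ᵥ e - b t) (h := fun t => a t ⬝ᵥ d - (1 + δ))
      ((a.continuous.dotProduct continuous_const).sub b.continuous)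
      ((a.continuous.dotProduct continuous_const).sub continuous_const)
      (fun t _ => sub_nonpos.2 (he t)) (fun t _ h0 => by
        have := hact t (sub_eq_zero.1 h0)
        linarith)
    obtain ⟨η, hη, hball⟩ := (@Metric.eventually_nhds_iff _ (normMetric p) _ _).1 hκ
    have hη' : 0 < η / (p d + 1) := div_pos hη (by positivity)
    set s := min r (η / (p d + 1)) / 2 with hs
    have hs0 : 0 < s := half_pos (lt_min hr hη')
    have hsr : s ≤ r := (half_le_self (le_min hr.le hη'.le)).trans (min_le_left _ _)
    have hsη : s < η / (p d + 1) := (half_lt_self (lt_min hr hη')).trans_le (min_le_right _ _)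
    have hdist : @dist _ (normMetric p).toDist (e + s • d) e < η := by
      have h0 : @dist _ (normMetric p).toDist (e + s • d) e = p (s • d) := by
        have h1 : @dist _ (normMetric p).toDist (e + s • d) e = p (-(e + s • d) + e) := rfl
        rw [h1, neg_add_eq_sub, sub_add_cancel_left, map_neg_eq_map]
      rw [h0, map_smul_eq_mul, Real.norm_eq_abs, abs_of_pos hs0]
      rw [lt_div_iff₀ (by positivity)] at hsη
      linarith
    have h1 := hball hdist
    have hM : 0 ≤ s * (1 + δ) := by positivity
    have h2 := infEDist_feasible_parameters_le (a := a) (b := b) (x := e + s • d) hM fun t => by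
      have h3 := hfeas t (Set.mem_univ t)
      have h4 : a t ⬝ᵥ e - b t ≤ 0 := sub_nonpos.2 (he t)
      rw [dotProduct_add, dotProduct_smul, smul_eq_mul]
      by_cases h5 : 0 ≤ a t ⬝ᵥ d - (1 + δ)
      · nlinarith [mul_le_mul_of_nonneg_right hsr h5]
      · nlinarith [mul_neg_of_pos_of_neg hs0 (not_le.1 h5)]
    have h3 : ENNReal.ofReal (s / dualNormReal p q) ≤ _ :=
      le_infEDist_normMetric (F := feasibleSet a b) (p := p) (x := e + s • d) fun y hy => by
        rw [div_le_iff₀ hN, mul_comm]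
        exact hpos y hy s
    have h4 := (h3.trans h1).trans (mul_le_mul_right h2 _)
    rw [← ENNReal.ofReal_coe_nnreal, ← ENNReal.ofReal_mul κ.coe_nonneg,
      ENNReal.ofReal_le_ofReal_iff (mul_nonneg κ.coe_nonneg hM)] at h4
    have h5 : s * (1 / dualNormReal p q) ≤ s * (κ * (1 + δ)) := by
      calc s * (1 / dualNormReal p q) = s / dualNormReal p q := by ring
        _ ≤ κ * (s * (1 + δ)) := h4
        _ = s * (κ * (1 + δ)) := by ring
    exact le_of_mul_le_mul_left h5 hs0
  have hlim : 1 / dualNormReal p q ≤ κ := by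
    have ht : Filter.Tendsto (fun δ : ℝ => (κ : ℝ) * (1 + δ)) (𝓝[>] 0) (𝓝 κ) := by
      have : Continuous fun δ : ℝ => (κ : ℝ) * (1 + δ) := by fun_prop
      simpa using this.continuousWithinAt (s := Set.Ioi 0) (x := 0) |>.tendsto
    refine ge_of_tendsto ht ?_
    filter_upwards [self_mem_nhdsWithin] with δ hδ using hreal δ hδ
  have hNq : dualNorm p q = ENNReal.ofReal (dualNormReal p q) :=
    (ENNReal.ofReal_toReal (dualNorm_ne_top hp q)).symm
  rw [zero_sub, dualNorm_neg, ENNReal.inv_le_iff_inv_le, hNq, ← ENNReal.ofReal_inv_of_pos hN, ← ENNReal.ofReal_coe_nnreal]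
  exact ENNReal.ofReal_le_ofReal (by rwa [one_div] at hlim)

/-- If x is feasible for b', then a_t'(x - e) ≤ dist b b' for t active at e. The cone estimate
transfers this to the normal u at the nearest point, and ‖u‖_* > 0 cancels. -/
theorem hofF_le_of_forall_inv_dualDist_le {p : Seminorm ℝ (Fin n → ℝ)}
    (hp : ∀ x, p x = 0 → x = 0) {a : C(T, Fin n → ℝ)} {b : C(T, ℝ)}
    (hb : (feasibleSet a b).Nonempty) (hLOP : IsLOP a b) {κ : ℝ≥0}
    (hκ : ∀ e ∈ extremeSet a b, ∀ D ∈ hyperplaneFamily a b e,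
      (dualDist p 0 (convexHull ℝ (a '' D)))⁻¹ ≤ κ) :
    hofF p a b ≤ κ := by
  refine iInf₂_le κ fun x => ?_
  by_cases hx : x ∈ feasibleSet a b
  · rw [@Metric.infEDist_zero_of_mem _ (normMetric p).toPseudoEMetricSpace _ _ hx]
    exact zero_le
  obtain ⟨y, hy, u, hnormal, hN, hu⟩ := exists_nearest_point_normal hp hb
    (isClosed_feasibleSet a b) (convex_feasibleSet a b) hx
  obtain ⟨e, he, hsub⟩ := hLOP.exists_mem_extremeSet hy
  have hucone := hLOP.normal_mem_closure_activeCone hy hnormal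
  have hue : u ∈ closure (Submodule.span ℝ≥0 (a '' activeIndices a b e) : Set (Fin n → ℝ)) :=
    closure_mono (Submodule.span_mono (Set.image_mono hsub)) hucone
  have huy : u ⬝ᵥ (x - y) ≤ u ⬝ᵥ (x - e) := by
    have h1 := hnormal e he.1.1
    rw [dotProduct_sub] at h1 ⊢
    rw [dotProduct_sub]
    linarith
  have hκ1 : ∀ d : Fin n → ℝ, (∀ s ∈ a '' activeIndices a b e, s ⬝ᵥ d ≤ 1) →
      ∀ q ∈ convexHull ℝ {s ∈ a '' activeIndices a b e | s ⬝ᵥ d = 1},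
        1 ≤ (κ : ℝ) * dualNormReal p q := by
    intro d hd q hq
    have hset : {s ∈ a '' activeIndices a b e | s ⬝ᵥ d = 1} =
        a '' {t ∈ activeIndices a b e | a t ⬝ᵥ d = 1} := by
      ext s
      constructor
      · rintro ⟨⟨t, ht, rfl⟩, h⟩
        exact ⟨t, ⟨ht, h⟩, rfl⟩
      · rintro ⟨t, ⟨ht, h⟩, rfl⟩
        exact ⟨⟨t, ht, rfl⟩, h⟩
    rw [hset] at hq
    -- The indices on an exposed face cut out by d are exactly a member of 𝒟(e), with d itself as
    -- witness.
    have h1 := hκ e he {t ∈ activeIndices a b e | a t ⬝ᵥ d = 1}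
      ⟨fun t ht => ht.1, d, fun t ht => ht.2, fun t ht =>
        lt_of_le_of_ne (hd _ ⟨t, ht.1, rfl⟩) fun h => ht.2 ⟨ht.1, h⟩⟩
    have h2 : dualDist p 0 (convexHull ℝ (a '' {t ∈ activeIndices a b e | a t ⬝ᵥ d = 1})) ≤
        dualNorm p (0 - q) := iInf₂_le q hq
    rw [zero_sub, dualNorm_neg] at h2
    have h3 := (ENNReal.inv_le_inv.2 h2).trans h1
    have h4 : dualNorm p q ≠ 0 := fun h => by simp [h] at h3
    have h5 : (1 : ℝ≥0∞) ≤ κ * dualNorm p q := by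
      rw [← ENNReal.inv_mul_cancel h4 (dualNorm_ne_top hp q)]
      gcongr
    have h6 := ENNReal.toReal_mono (ENNReal.mul_ne_top ENNReal.coe_ne_top
      (dualNorm_ne_top hp q)) h5
    simpa [dualNormReal] using h6
  refine (infEDist_normMetric_le hy).trans ?_
  -- The parameter t ↦ a_t'x admits x, so the parameter distance is finite and the product κ · ∞
  -- never arises.
  have hne : {b' | x ∈ feasibleSet a b'}.Nonempty :=
    ⟨⟨fun t => a t ⬝ᵥ x, a.continuous.dotProduct continuous_const⟩, fun t => le_rfl⟩
  refine ENNReal.le_mul_of_forall_lt (.inr (Metric.infEDist_ne_top hne))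
    (.inl ENNReal.coe_ne_top) fun κ' hκ' M hM => ?_
  obtain ⟨b', hb', hM'⟩ := Metric.infEDist_lt_iff.1 hM
  have hdist : ENNReal.ofReal (p (x - y)) ≤ κ * edist b b' := by
    rw [edist_dist, ← ENNReal.ofReal_coe_nnreal, ← ENNReal.ofReal_mul κ.coe_nonneg]
    refine ENNReal.ofReal_le_ofReal ?_
    have h1 := dotProduct_le_of_mem_closure_cone hp
      (isCompact_image_activeIndices a b e) (dist_nonneg (x := b) (y := b')) hκ1 (z := x - e) (by
        rintro _ ⟨t, ht, rfl⟩
        have h2 : a t ⬝ᵥ e = b t := ht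
        have h3 : a t ⬝ᵥ x ≤ b' t := hb' t
        have h4 := ContinuousMap.dist_apply_le_dist (f := b) (g := b') t
        rw [Real.dist_eq, abs_sub_comm] at h4
        rw [dotProduct_sub]
        linarith [le_abs_self (b' t - b t)]) hue κ.2
    refine le_of_mul_le_mul_left ?_ hN
    calc dualNormReal p u * p (x - y) ≤ _ := (hu.trans huy).trans h1
      _ = dualNormReal p u * (κ * dist b b') := by ring
  exact hdist.trans (mul_le_mul' hκ'.le hM'.le)

theorem hofF_le_iSup {p : Seminorm ℝ (Fin n → ℝ)}
    (hp : ∀ x, p x = 0 → x = 0) {a : C(T, Fin n → ℝ)} {b : C(T, ℝ)}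
    (hb : (feasibleSet a b).Nonempty) (hLOP : IsLOP a b) :
    hofF p a b ≤ ⨆ x ∈ extremeSet a b, ⨆ D ∈ hyperplaneFamily a b x,
      (dualDist p 0 (convexHull ℝ (a '' D)))⁻¹ := by
  generalize hK : (⨆ x ∈ extremeSet a b, ⨆ D ∈ hyperplaneFamily a b x,
      (dualDist p 0 (convexHull ℝ (a '' D)))⁻¹) = K
  rcases eq_or_ne K ∞ with h | h
  · rw [h]
    exact le_top
  · lift K to ℝ≥0 using h
    refine hofF_le_of_forall_inv_dualDist_le hp hb hLOP fun e he D hD => ?_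
    rw [← hK]
    refine le_trans ?_ (le_iSup₂ (f := fun e (_ : e ∈ extremeSet a b) =>
      ⨆ D ∈ hyperplaneFamily a b e, (dualDist p 0 (convexHull ℝ (a '' D)))⁻¹) e he)
    exact le_iSup₂ (f := fun (D : Set T) (_ : D ∈ hyperplaneFamily a b e) =>
      (dualDist p 0 (convexHull ℝ (a '' D)))⁻¹) D hD

/-! ### Attainment for finite systems -/

theorem exists_eq_biSup_of_finite {ι α : Type*} [CompleteLinearOrder α] {s : Set ι}
    (hs : s.Finite) (hne : s.Nonempty) (f : ι → α) : ∃ i ∈ s, ⨆ j ∈ s, f j = f i := by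
  obtain ⟨i, hi, hmax⟩ := Set.exists_max_image s f hs hne
  exact ⟨i, hi, le_antisymm (iSup₂_le hmax) (le_iSup₂ (f := fun j (_ : j ∈ s) => f j) i hi)⟩

end LinSys

theorem mainTheorem3 {n : ℕ} {T : Type*} [TopologicalSpace T] [CompactSpace T] [T2Space T]
    (p : Seminorm ℝ (Fin n → ℝ)) (hp : ∀ x, p x = 0 → x = 0)
    (a : C(T, Fin n → ℝ)) (b : C(T, ℝ))
    (hb : (LinSys.feasibleSet a b).Nonempty) (hLOP : LinSys.IsLOP a b) :
    (LinSys.hofF p a b = ⨆ x ∈ LinSys.extremeSet a b, LinSys.clmF p a b x) ∧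
    (LinSys.hofF p a b = ⨆ x ∈ LinSys.extremeSet a b, ⨆ D ∈ LinSys.hyperplaneFamily a b x,
      (LinSys.dualDist p 0 (convexHull ℝ (a '' D)))⁻¹) ∧
    (Finite T →
      (LinSys.extremeSet a b).Finite ∧ (LinSys.extremeSet a b).Nonempty ∧
      (∀ x ∈ LinSys.extremeSet a b,
        (LinSys.hyperplaneFamily a b x).Finite ∧ (LinSys.hyperplaneFamily a b x).Nonempty) ∧
      (∃ x ∈ LinSys.extremeSet a b, LinSys.hofF p a b = LinSys.clmF p a b x) ∧
      (∃ x ∈ LinSys.extremeSet a b, ∃ D ∈ LinSys.hyperplaneFamily a b x,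
        LinSys.hofF p a b = (LinSys.dualDist p 0 (convexHull ℝ (a '' D)))⁻¹)) := by
  have hle := LinSys.hofF_le_iSup hp hb hLOP
  have hmid : (⨆ x ∈ LinSys.extremeSet a b, ⨆ D ∈ LinSys.hyperplaneFamily a b x,
      (LinSys.dualDist p 0 (convexHull ℝ (a '' D)))⁻¹) ≤
      ⨆ x ∈ LinSys.extremeSet a b, LinSys.clmF p a b x :=
    iSup₂_mono fun x hx => iSup₂_le fun D hD => LinSys.inv_dualDist_le_clmF hp hx.1.1 hD
  have hge : (⨆ x ∈ LinSys.extremeSet a b, LinSys.clmF p a b x) ≤ LinSys.hofF p a b :=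
    iSup₂_le fun x _ => LinSys.clmF_le_hofF p a b x
  have h1 := le_antisymm (hle.trans hmid) hge
  have h2 := le_antisymm hle (hmid.trans hge)
  refine ⟨h1, h2, fun _ => ?_⟩
  obtain ⟨x₀, hx₀⟩ := hb
  obtain ⟨e₀, he₀, -⟩ := hLOP.exists_mem_extremeSet hx₀
  -- Extreme points inject into the finite power set of T through their active indices.
  have hE : (LinSys.extremeSet a b).Finite :=
    Set.Finite.of_finite_image (Set.toFinite _) hLOP.activeIndices_injOn
  refine ⟨hE, ⟨e₀, he₀⟩, fun x _ => ⟨Set.toFinite _, ∅, LinSys.empty_mem_hyperplaneFamily a b x⟩,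
    ?_, ?_⟩
  · obtain ⟨x, hx, h⟩ := LinSys.exists_eq_biSup_of_finite hE ⟨e₀, he₀⟩ (LinSys.clmF p a b)
    exact ⟨x, hx, h1.trans h⟩
  · obtain ⟨x, hx, h⟩ := LinSys.exists_eq_biSup_of_finite hE ⟨e₀, he₀⟩
      fun x => ⨆ D ∈ LinSys.hyperplaneFamily a b x,
        (LinSys.dualDist p 0 (convexHull ℝ (a '' D)))⁻¹
    obtain ⟨D, hD, h'⟩ := LinSys.exists_eq_biSup_of_finite
      (Set.toFinite (LinSys.hyperplaneFamily a b x))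
      ⟨∅, LinSys.empty_mem_hyperplaneFamily a b x⟩
      fun D => (LinSys.dualDist p 0 (convexHull ℝ (a '' D)))⁻¹
    exact ⟨x, hx, D, hD, (h2.trans h).trans h'⟩
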